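/- Let $L$ be a locale (a frame, i.e. a complete Heyting algebra), and let $(\mathsf S(L),\subseteq)$ be the coframe of its sublocales, i.e. of the subsets $S\subseteq L$ that are closed under arbitrary meets and satisfy $x\to s\in S$ for all $x\in L$, $s\in S$. For $a\in L$ the open sublocale is $\mathfrak o(a)=\{a\to x: x\in L\}$ and the closed sublocale is $\mathfrak c(a)=\{x\in L: a\le x\}$. On $\mathsf S(L)$ let $c(S)$ be the smallest closed sublocale containing $S$, let $i(S)$ be the largest open sublocale contained in $S$, and let $-S$ be the supplement (co-pseudocomplement) of $S$, i.e. the smallest sublocale $T$ with $S\vee T=L$. Words in $c,i,-$ denote composite operators, with the rightmost letter acting first, and $\mathsf{id}$ is the empty word. For words $v,w$ say that $v\le w$ (resp. $v=w$) holds in general if $v(S)\subseteq w(S)$ (resp. $v(S)=w(S)$) for every locale $L$ and every $S\in\mathsf S(L)$. Consider the diagram whose $21$ nodes are the words $$c,\ c{-}{-},\ cic,\ cic{-}{-},\ ci,\ ic,\ ic{-}{-},\ ici,\ i,\ \mathsf{id},\ {-}{-},$$ $${-}i,\ {-},\ {-}ici,\ ci{-},\ {-}ci,\ {-}ic,\ ici{-},\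 i{-},\ {-}cic,\ {-}c,$$ and whose edges, each written (lower node) $<$ (upper node), are the consecutive pairs in the following chains. On the first $11$ nodes: $$i<ici<ic{-}{-}<ic<cic<c,\qquad ici<ci<cic{-}{-}<cic,\qquad ic{-}{-}<cic{-}{-}<c{-}{-},$$ $$i<{-}{-}<\mathsf{id}<c,\qquad {-}{-}<c{-}{-}<c;$$ on the other $10$ nodes: $${-}c<i{-}<{-}<{-}i,\qquad {-}c<{-}cic<ici{-}<{-}ci<{-}ici<{-}i,$$ $$i{-}<ici{-}<ci{-}<{-}ici,\qquad {-}cic<{-}ic<ci{-}.$$ **Theorem.** This diagram is the Hasse diagram of the closure--interior--supplement operator monoid, and it is complete. That is: 1. For every word in $c,i,-$ there is a node that equals it in general (so the monoid generated by $c,i,-$ on $\mathsf S(L)$ has at most $21$ elements for every $L$). 2. No two distinct nodes are equal in general. 3. For nodes $v,w$, the inequality $v\le w$ holds in general if and only if there is an ascending (possibly trivial) path of edges from $v$ to $w$. In particular no inequality holds in general beyond those shown: for every other ordered pair of nodes there are a locale $L$ and a sublocale $S\in\mathsf S(L)$ with $v(S)\not\subseteq w(S)$. 4. The edges are exactly the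 covering pairs: $(v,w)$ is an edge if and only if $v\neq w$ are nodes, $v\le w$ holds in general, and no node other than $v,w$ lies between them, i.e. every node $z$ for which $v\le z$ and $z\le w$ hold in general is $v$ or $w$. -/

import Mathlib

universe u

/-! Locales are frames `L`; `Sublocale L` is the coframe `S(L)` of sublocales of `L`, ordered by
inclusion, and `￢S` is its co-pseudocomplement, i.e. the supplement of `S`: the least sublocale
whose join with `S` is the whole of `L`. -/

namespace LocalicCIS

/-- The open sublocale `𝔬(a) = {a ⇨ x | x ∈ L}`. -/
def openSublocale {L : Type*} [Order.Frame L] (a : L) : Sublocale L where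
  carrier := Set.range fun x => a ⇨ x
  sInf_mem' s hs := by
    refine ⟨sInf s, ?_⟩
    show a ⇨ sInf s = sInf s
    refine le_antisymm (le_sInf fun b hb => ?_) le_himp
    obtain ⟨x, rfl⟩ := hs hb
    calc a ⇨ sInf s ≤ a ⇨ (a ⇨ x) := himp_le_himp_left (sInf_le hb)
      _ = a ⇨ x := himp_idem
  himp_mem' b y hy := by
    obtain ⟨x, rfl⟩ := hy
    exact ⟨b ⇨ x, himp_left_comm a b x⟩

/-- The closed sublocale `𝔠(a) = {x ∈ L | a ≤ x}`. -/
def closedSublocale {L : Type*} [Order.Frame L] (a : L) : Sublocale L where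
  carrier := Set.Ici a
  sInf_mem' _ hs := le_sInf fun _ hb => hs hb
  himp_mem' _ _ hb := le_trans hb le_himp

/-- The interior of `S`: the join of all open sublocales contained in `S`. -/
noncomputable def interior {L : Type*} [Order.Frame L] (S : Sublocale L) : Sublocale L :=
  sSup {T | (∃ a, T = openSublocale a) ∧ T ≤ S}

/-- The closure of `S`: the intersection of all closed sublocales containing `S`. -/
noncomputable def closure {L : Type*} [Order.Frame L] (S : Sublocale L) : Sublocale L :=
  sInf {T | (∃ a, T = closedSublocale a) ∧ S ≤ T}

/-- The interior is the largest open sublocale contained in `S`. -/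
theorem isGreatest_interior {L : Type*} [Order.Frame L] (S : Sublocale L) :
    IsGreatest {T | (∃ a, T = openSublocale a) ∧ T ≤ S} (interior S) := by
  have key : IsGreatest {T | (∃ a, T = openSublocale a) ∧ T ≤ S}
      (openSublocale (sSup {a : L | openSublocale a ≤ S})) := by
    refine ⟨⟨⟨_, rfl⟩, ?_⟩, ?_⟩
    · rintro _ ⟨x, rfl⟩
      have h : sSup {a : L | openSublocale a ≤ S} ⇨ x =
          ⨅ a : L, ⨅ _ : openSublocale a ≤ S, a ⇨ x := by
        refine eq_of_forall_le_iff fun y => ?_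
        simp only [le_iInf_iff, le_himp_comm (a := y), sSup_le_iff, Set.mem_ofPred_eq]
      show sSup {a : L | openSublocale a ≤ S} ⇨ x ∈ S
      rw [h]
      exact Sublocale.iInf_mem fun a => Sublocale.iInf_mem fun ha => ha ⟨x, rfl⟩
    · rintro _ ⟨⟨a, rfl⟩, ha⟩ _ ⟨x, rfl⟩
      refine ⟨a ⇨ x, ?_⟩
      show sSup {a : L | openSublocale a ≤ S} ⇨ (a ⇨ x) = a ⇨ x
      rw [himp_himp, inf_eq_right.2 (le_sSup (show a ∈ {a : L | openSublocale a ≤ S} from ha))]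
  rw [interior, key.isLUB.sSup_eq]
  exact key

/-- The closure is the smallest closed sublocale containing `S`. -/
theorem isLeast_closure {L : Type*} [Order.Frame L] (S : Sublocale L) :
    IsLeast {T | (∃ a, T = closedSublocale a) ∧ S ≤ T} (closure S) := by
  have key : IsLeast {T | (∃ a, T = closedSublocale a) ∧ S ≤ T}
      (closedSublocale (sInf (S : Set L))) := by
    refine ⟨⟨⟨_, rfl⟩, fun x hx => sInf_le hx⟩, ?_⟩
    rintro _ ⟨⟨a, rfl⟩, ha⟩ x hx
    exact le_trans (le_sInf fun y hy => ha hy) hx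
  rw [closure, key.isGLB.sInf_eq]
  exact key

/-- The supplement is the least sublocale whose join with `S` is the whole locale. -/
theorem isLeast_supplement {L : Type*} [Order.Frame L] (S : Sublocale L) :
    IsLeast {T | S ⊔ T = ⊤} (￢S) :=
  ⟨codisjoint_iff.1 codisjoint_hnot_right,
    fun _ hT => (codisjoint_iff.2 hT).hnot_le_right⟩

/-- The three generating operators: closure `c`, interior `i` and supplement `n` (written `-`). -/
inductive Letter
  | c
  | i
  | n
  deriving DecidableEq

/-- The operator on `S(L)` named by a letter. -/
noncomputable def Letter.op {L : Type*} [Order.Frame L] : Letter → Sublocale L → Sublocale L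
  | .c, S => closure S
  | .i, S => interior S
  | .n, S => ￢S

/-- Words in `c`, `i`, `-`, that is, formal composites of the generators. -/
abbrev Word := List Letter

/-- The operator on `S(L)` named by a word; the rightmost letter acts first, so that for instance
`[i, c, n]` names `S ↦ i (c (-S))` and the empty word names the identity. -/
noncomputable def Word.op {L : Type*} [Order.Frame L] : Word → Sublocale L → Sublocale L
  | [], S => S
  | x :: w, S => x.op (Word.op w S)

/-- The inequality `v ≤ w` holds in general: on `S(L)` for every locale `L`. -/
def HoldsLE (v w : Word) : Prop :=
  ∀ (L : Type u) [Order.Frame L] (S : Sublocale L), Word.op v S ≤ Word.op w S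

/-- The equation `v = w` holds in general: on `S(L)` for every locale `L`. -/
def HoldsEq (v w : Word) : Prop :=
  ∀ (L : Type u) [Order.Frame L] (S : Sublocale L), Word.op v S = Word.op w S

open Letter in
/-- The 21 nodes of the diagram (first the 11 words with an even number of supplements, then the
10 words with an odd number). -/
def nodes : List Word :=
  [[c], [c, n, n], [c, i, c], [c, i, c, n, n], [c, i], [i, c], [i, c, n, n], [i, c, i], [i],
    [], [n, n],
   [n, i], [n], [n, i, c, i], [c, i, n], [n, c, i], [n, i, c], [i, c, i, n], [i, n],
    [n, c, i, c], [n, c]]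

open Letter in
/-- The edges of the diagram, each listed as (lower node, upper node). -/
def edges : List (Word × Word) :=
  [([i], [i, c, i]), ([i, c, i], [i, c, n, n]), ([i, c, n, n], [i, c]), ([i, c], [c, i, c]),
   ([c, i, c], [c]),
   ([i, c, i], [c, i]), ([c, i], [c, i, c, n, n]), ([c, i, c, n, n], [c, i, c]),
   ([i, c, n, n], [c, i, c, n, n]), ([c, i, c, n, n], [c, n, n]),
   ([i], [n, n]), ([n, n], []), ([], [c]),
   ([n, n], [c, n, n]), ([c, n, n], [c]),
   ([n, c], [i, n]), ([i, n], [n]), ([n], [n, i]),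
   ([n, c], [n, c, i, c]), ([n, c, i, c], [i, c, i, n]), ([i, c, i, n], [n, c, i]),
   ([n, c, i], [n, i, c, i]), ([n, i, c, i], [n, i]),
   ([i, n], [i, c, i, n]), ([i, c, i, n], [c, i, n]), ([c, i, n], [n, i, c, i]),
   ([n, c, i, c], [n, i, c]), ([n, i, c], [c, i, n])]

/-- `(v, w)` is an edge of the diagram, with `v` the lower and `w` the upper node. -/
def Edge (v w : Word) : Prop := (v, w) ∈ edges

/-- `v` lies below or equals `w` in the diagram: there is an ascending path from `v` to `w`. -/
def DiagramLE : Word → Word → Prop := Relation.ReflTransGen Edge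

end LocalicCIS

/-!
Open and closed sublocales are complementary, so the supplement exchanges them, and
`closure_hnot` and `interior_hnot` push it past the other operators: `c- = -i` and `i- = -c--`.
(Pointwise topology would give `i- = -c`; here `--S` may be strictly smaller than `S`.) Together
with `cici = ci`, `icic = ic` and `--- = -` this brings every word to the form `v`, `v--`, `-v` or
`-v--`, where `v` is one of the seven alternating words `id`, `c`, `i`, `ci`, `ic`, `cic`, `ici`.
A trailing `--` is absorbed by `i`, and `---` collapses to `-`, which leaves the 21 nodes:
`exists_node_cons` records that they are stable under composition with a letter on the left. The
edges follow from monotonicity of `c` and `i`, antitonicity of `-`, and `i ≤ -- ≤ id ≤ c`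
(`Edge.holdsLE`).

Every other inequality between nodes fails in one of three families of sublocales, each stable
under the three operations, so that words can be evaluated on finitely many names
(`Model.Realization`):
* over the locale of open sets of the real line, the Boolean algebra generated by the open
  sublocales of the two half-lines and the closed sublocale of the origin (`threePointRealization`); it
  separates the operators that Kuratowski's topological theorem separates, up to the failures that
  need a dense sublocale with empty interior;
* over the chain `⊤ > 1 > 2 > ⋯ > ⊥`, whose sublocales are the subsets containing `⊤` and closed
  under meets, two complementary dense sublocales
  (`DescChain.resolvableRealization`), which have empty interior;
* over the same chain, the sublocale `S = {⊤, ⊥}` (`DescChain.smallDenseRealization`). A sublocale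
  that contains all elements other than `⊥` contains their meet `⊥`; hence `-S` is everything,
  `--S` is the least sublocale `⊥`, and `S` is dense all the same.

That these models refute everything outside the diagram is a finite check
(`mem_reach_of_modelLE`); the description of the order as the reflexive transitive closure of the
edges, and of the edges as its covering pairs, follows.
-/

namespace LocalicCIS

section Frame

variable {L : Type*} [Order.Frame L] {a b x : L} {S T : Sublocale L}

/-! ### Open and closed sublocales -/

theorem mem_openSublocale : x ∈ openSublocale a ↔ a ⇨ x = x :=
  ⟨by rintro ⟨y, rfl⟩; exact himp_idem, fun h => ⟨x, h⟩⟩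

theorem mem_closedSublocale : x ∈ closedSublocale a ↔ a ≤ x := Iff.rfl

theorem mem_top : x ∈ (⊤ : Sublocale L) :=
  (le_top : closedSublocale (⊥ : L) ≤ ⊤) (mem_closedSublocale.2 bot_le)

theorem mem_bot : x ∈ (⊥ : Sublocale L) ↔ x = ⊤ := by
  refine ⟨fun h => ?_, fun h => h ▸ Sublocale.top_mem⟩
  exact top_le_iff.1 ((bot_le : ⊥ ≤ closedSublocale (⊤ : L)) h)

theorem isCompl_open_closed (a : L) : IsCompl (openSublocale a) (closedSublocale a) := by
  constructor
  · refine fun T ho hc x hx => mem_bot.2 ?_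
    rw [← mem_openSublocale.1 (ho hx)]
    exact himp_eq_top_iff.2 (hc hx)
  · intro T ho hc x _
    -- every element is the meet of one in `𝔬(a)` and one in `𝔠(a)`
    have h : x = (a ⇨ x) ⊓ (a ⊔ x) := by
      rw [inf_sup_left, himp_inf_self, inf_eq_right.2 (le_himp : x ≤ a ⇨ x)]
      exact (sup_eq_right.2 inf_le_left).symm
    rw [h]
    exact Sublocale.inf_mem (ho ⟨x, rfl⟩) (hc (mem_closedSublocale.2 le_sup_left))

theorem hnot_openSublocale (a : L) : ￢openSublocale a = closedSublocale a :=
  (isCompl_open_closed a).hnot_eq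

theorem hnot_closedSublocale (a : L) : ￢closedSublocale a = openSublocale a :=
  (isCompl_open_closed a).symm.hnot_eq

theorem closedSublocale_le_closedSublocale : closedSublocale a ≤ closedSublocale b ↔ b ≤ a :=
  ⟨fun h => h (mem_closedSublocale.2 le_rfl), fun h _ hx => h.trans hx⟩

theorem openSublocale_le_openSublocale : openSublocale a ≤ openSublocale b ↔ a ≤ b := by
  rw [← hnot_closedSublocale, ← hnot_closedSublocale, ← closedSublocale_le_closedSublocale]
  refine ⟨fun h => ?_, fun h => hnot_anti h⟩
  simpa only [hnot_closedSublocale, hnot_openSublocale] using hnot_anti h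

theorem openSublocale_le_closedSublocale :
    openSublocale a ≤ closedSublocale b ↔ Disjoint a b := by
  rw [disjoint_comm, disjoint_iff_inf_le, ← le_himp_iff]
  refine ⟨fun h => h ⟨⊥, rfl⟩, ?_⟩
  rintro h _ ⟨x, rfl⟩
  exact mem_closedSublocale.2 (h.trans (himp_le_himp_left bot_le))

theorem closedSublocale_le_openSublocale :
    closedSublocale a ≤ openSublocale b ↔ a ⊔ b = ⊤ := by
  refine ⟨fun h => ?_, fun h x hx => mem_openSublocale.2 ?_⟩
  · rw [← mem_openSublocale.1 (h (mem_closedSublocale.2 (le_sup_left : a ≤ a ⊔ b)))]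
    exact himp_eq_top_iff.2 le_sup_right
  · rw [mem_closedSublocale, ← himp_eq_top_iff] at hx
    rw [← top_inf_eq (b ⇨ x), ← hx, ← sup_himp_distrib, h, top_himp]

theorem closedSublocale_bot : closedSublocale (⊥ : L) = ⊤ :=
  top_le_iff.1 fun _ _ => mem_closedSublocale.2 bot_le

theorem closedSublocale_top : closedSublocale (⊤ : L) = ⊥ :=
  le_bot_iff.1 fun _ hx => mem_bot.2 (top_le_iff.1 hx)

theorem openSublocale_bot : openSublocale (⊥ : L) = ⊥ := by
  rw [← hnot_closedSublocale, closedSublocale_bot, hnot_top]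

theorem openSublocale_top : openSublocale (⊤ : L) = ⊤ := by
  rw [← hnot_closedSublocale, closedSublocale_top, hnot_bot]

/-! ### Laws of closure, interior and supplement -/

theorem le_closure (S : Sublocale L) : S ≤ closure S := (isLeast_closure S).1.2

theorem interior_le (S : Sublocale L) : interior S ≤ S := (isGreatest_interior S).1.2

theorem closure_eq_closedSublocale (S : Sublocale L) : ∃ a, closure S = closedSublocale a :=
  (isLeast_closure S).1.1

theorem interior_eq_openSublocale (S : Sublocale L) : ∃ a, interior S = openSublocale a :=
  (isGreatest_interior S).1.1

theorem closure_le_closedSublocale : closure S ≤ closedSublocale a ↔ S ≤ closedSublocale a :=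
  ⟨(le_closure S).trans, fun h => (isLeast_closure S).2 ⟨⟨a, rfl⟩, h⟩⟩

theorem openSublocale_le_interior : openSublocale a ≤ interior S ↔ openSublocale a ≤ S :=
  ⟨fun h => h.trans (interior_le S), fun h => (isGreatest_interior S).2 ⟨⟨a, rfl⟩, h⟩⟩

theorem closure_closedSublocale (a : L) : closure (closedSublocale a) = closedSublocale a :=
  (closure_le_closedSublocale.2 le_rfl).antisymm (le_closure _)

theorem interior_openSublocale (a : L) : interior (openSublocale a) = openSublocale a :=
  (interior_le _).antisymm (openSublocale_le_interior.2 le_rfl)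

theorem closure_mono : Monotone (closure : Sublocale L → Sublocale L) := fun S T h => by
  obtain ⟨a, ha⟩ := closure_eq_closedSublocale T
  rw [ha, closure_le_closedSublocale, ← ha]
  exact h.trans (le_closure T)

theorem interior_mono : Monotone (interior : Sublocale L → Sublocale L) := fun S T h => by
  obtain ⟨a, ha⟩ := interior_eq_openSublocale S
  rw [ha, openSublocale_le_interior, ← ha]
  exact (interior_le S).trans h

theorem closure_closure (S : Sublocale L) : closure (closure S) = closure S := by
  obtain ⟨a, ha⟩ := closure_eq_closedSublocale S
  rw [ha, closure_closedSublocale]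

theorem interior_interior (S : Sublocale L) : interior (interior S) = interior S := by
  obtain ⟨a, ha⟩ := interior_eq_openSublocale S
  rw [ha, interior_openSublocale]

theorem hnot_hnot_closure (S : Sublocale L) : ￢￢closure S = closure S := by
  obtain ⟨a, ha⟩ := closure_eq_closedSublocale S
  rw [ha, hnot_closedSublocale, hnot_openSublocale]

theorem hnot_hnot_interior (S : Sublocale L) : ￢￢interior S = interior S := by
  obtain ⟨a, ha⟩ := interior_eq_openSublocale S
  rw [ha, hnot_openSublocale, hnot_closedSublocale]

theorem hnot_le_closedSublocale : ￢S ≤ closedSublocale a ↔ openSublocale a ≤ S := by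
  rw [← hnot_openSublocale]
  refine ⟨fun h => ?_, fun h => hnot_anti h⟩
  have := (hnot_anti h).trans hnot_hnot_le
  rwa [hnot_openSublocale, hnot_closedSublocale] at this

/-- By `hnot_le_closedSublocale`, the closed sublocales containing `-S` are the complements of the
open sublocales contained in `S`. -/
theorem closure_hnot (S : Sublocale L) : closure (￢S) = ￢interior S := by
  obtain ⟨a, ha⟩ := closure_eq_closedSublocale (￢S)
  obtain ⟨b, hb⟩ := interior_eq_openSublocale S
  apply le_antisymm
  · rw [hb, hnot_openSublocale, closure_le_closedSublocale, hnot_le_closedSublocale, ← hb]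
    exact interior_le S
  · rw [ha, hnot_le_closedSublocale, openSublocale_le_interior, ← hnot_le_closedSublocale, ← ha]
    exact le_closure _

/-- The supplement loses information, so `i(-S)` is governed by `--S` rather than by `S`. -/
theorem interior_hnot (S : Sublocale L) : interior (￢S) = ￢closure (￢￢S) := by
  rw [closure_hnot, hnot_hnot_interior]

theorem interior_hnot_hnot (S : Sublocale L) : interior (￢￢S) = interior S := by
  rw [interior_hnot, hnot_hnot_hnot, closure_hnot, hnot_hnot_interior]

theorem closure_hnot_closure (S : Sublocale L) : closure (￢closure S) = ￢interior (closure S) :=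
  closure_hnot _

theorem closure_hnot_interior (S : Sublocale L) : closure (￢interior S) = ￢interior S := by
  rw [closure_hnot, interior_interior]

theorem closure_interior_le_closure (S : Sublocale L) :
    closure (interior (closure S)) ≤ closure S := by
  simpa only [closure_closure] using closure_mono (interior_le (closure S))

theorem interior_le_interior_closure (S : Sublocale L) :
    interior S ≤ interior (closure (interior S)) := by
  simpa only [interior_interior] using interior_mono (le_closure (interior S))

theorem closure_interior_closure_interior (S : Sublocale L) :
    closure (interior (closure (interior S))) = closure (interior S) :=
  (closure_interior_le_closure _).antisymm (closure_mono (interior_le_interior_closure S))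

theorem interior_closure_interior_closure (S : Sublocale L) :
    interior (closure (interior (closure S))) = interior (closure S) :=
  (interior_mono (closure_interior_le_closure S)).antisymm (interior_le_interior_closure _)

theorem interior_le_hnot_hnot (S : Sublocale L) : interior S ≤ ￢￢S := by
  rw [← hnot_hnot_interior]
  exact hnot_anti (hnot_anti (interior_le S))

theorem closure_openSublocale (a : L) : closure (openSublocale a) = closedSublocale aᶜ := by
  obtain ⟨b, hb⟩ := closure_eq_closedSublocale (openSublocale a)
  apply le_antisymm
  · rw [closure_le_closedSublocale, openSublocale_le_closedSublocale]
    exact disjoint_compl_right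
  · rw [hb, closedSublocale_le_closedSublocale, le_compl_iff_disjoint_left,
      ← openSublocale_le_closedSublocale, ← hb]
    exact le_closure _

theorem interior_closedSublocale (a : L) : interior (closedSublocale a) = openSublocale aᶜ := by
  rw [← hnot_openSublocale, interior_hnot, hnot_openSublocale, hnot_closedSublocale,
    closure_openSublocale, hnot_closedSublocale]

theorem closure_bot : closure (⊥ : Sublocale L) = ⊥ := by
  rw [← closedSublocale_top, closure_closedSublocale]

theorem closure_top : closure (⊤ : Sublocale L) = ⊤ := top_le_iff.1 (le_closure _)

theorem interior_bot : interior (⊥ : Sublocale L) = ⊥ := le_bot_iff.1 (interior_le _)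

theorem interior_top : interior (⊤ : Sublocale L) = ⊤ := by
  rw [← openSublocale_top, interior_openSublocale]

theorem closure_eq_top (h : ⊥ ∈ S) : closure S = ⊤ := by
  obtain ⟨a, ha⟩ := closure_eq_closedSublocale S
  have := le_closure S h
  rw [ha, mem_closedSublocale, le_bot_iff] at this
  rw [ha, this, closedSublocale_bot]

end Frame

/-! ### Reduction of words to the nodes -/

/-- The set of operators named by the nodes is stable under composition with a letter. -/
theorem exists_node_cons (x : Letter) {v : Word} (hv : v ∈ nodes) :
    ∃ u ∈ nodes, HoldsEq.{u} (x :: v) u := by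
  -- `c-` and `i--` are treated apart: rewriting by `closure_hnot` in general would undo
  -- `interior_hnot` and would break up the nodes that contain `c--`
  by_cases h₁ : x = .c ∧ v = [.n]
  · obtain ⟨rfl, rfl⟩ := h₁
    exact ⟨[.n, .i], by simp [nodes], fun L _ S => closure_hnot S⟩
  by_cases h₂ : x = .i ∧ v = [.n, .n]
  · obtain ⟨rfl, rfl⟩ := h₂
    exact ⟨[.i], by simp [nodes], fun L _ S => interior_hnot_hnot S⟩
  simp only [nodes, List.mem_cons, List.not_mem_nil, or_false] at hv
  rcases hv with rfl | rfl | rfl | rfl | rfl | rfl | rfl | rfl | rfl | rfl | rfl | rfl | rfl |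
    rfl | rfl | rfl | rfl | rfl | rfl | rfl | rfl <;> cases x <;>
  first
  | simp at h₁; done
  | simp at h₂; done
  | simp only [nodes, List.mem_cons, exists_eq_or_imp, HoldsEq, Word.op, Letter.op, interior_hnot,
      closure_hnot_closure, closure_hnot_interior, hnot_hnot_hnot, hnot_hnot_closure,
      hnot_hnot_interior, closure_closure, interior_interior, closure_interior_closure_interior,
      interior_closure_interior_closure, implies_true, true_or, or_true]

theorem exists_node (w : Word) : ∃ v ∈ nodes, HoldsEq.{u} w v := by
  induction w with
  | nil => exact ⟨[], by simp [nodes], fun _ _ _ => rfl⟩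
  | cons x w ih =>
    obtain ⟨v, hv, hwv⟩ := ih
    obtain ⟨u, hu, hvu⟩ := exists_node_cons.{u} x hv
    exact ⟨u, hu, fun L _ S => (congrArg x.op (hwv L S)).trans (hvu L S)⟩

/-! ### The inequalities of the diagram -/

theorem Edge.holdsLE {v w : Word} (h : Edge v w) : HoldsLE.{u} v w := by
  intro L _ S
  -- each fact is named after its two sides, with `n` for the supplement
  have i_ici := interior_le_interior_closure S
  have i_nn := interior_le_hnot_hnot S
  have nn_id : ￢￢S ≤ S := hnot_hnot_le
  have i_id := interior_le S
  have id_c := le_closure S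
  have cnn_c := closure_mono nn_id
  have icnn_ic := interior_mono cnn_c
  have cicnn_cic := closure_mono icnn_ic
  have cic_c := closure_interior_le_closure S
  have cicnn_cnn := closure_interior_le_closure (￢￢S)
  have ici_icnn := interior_mono (closure_mono i_nn)
  have ci_cicnn := closure_mono (i_ici.trans ici_icnn)
  have nn_cnn := le_closure (￢￢S)
  have ic_cic := le_closure (interior (closure S))
  have icnn_cicnn := le_closure (interior (closure (￢￢S)))
  have ici_ci := interior_le (closure (interior S))
  have nc_ncnn := hnot_anti cnn_c
  have ncnn_n : ￢closure (￢￢S) ≤ ￢S := by simpa only [hnot_hnot_hnot] using hnot_anti nn_cnn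
  simp only [Edge, edges, List.mem_cons, Prod.mk.injEq, List.not_mem_nil, or_false] at h
  rcases h with h | h | h | h | h | h | h | h | h | h | h | h | h | h | h | h | h | h | h | h | h |
    h | h | h | h | h | h | h <;> obtain ⟨rfl, rfl⟩ := h <;>
  simp only [Word.op, Letter.op, interior_hnot, closure_hnot_closure,
    hnot_hnot_interior] <;>
  first | assumption | exact hnot_anti (by assumption)

theorem DiagramLE.holdsLE {v w : Word} (h : DiagramLE v w) : HoldsLE.{u} v w := by
  induction h with
  | refl => exact fun _ _ _ => le_rfl
  | tail _ h ih => exact fun L _ S => (ih L S).trans (h.holdsLE L S)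

/-! ### Finite models of the three operations -/

/-- A finite model of the action of the letters on sublocales: `V` is a set of names for
sublocales, `act` the action of the letters on names. The order of `V` is meant to contain all
inclusions between the named sublocales. -/
abbrev Model (V : Type) := Letter → V → V

/-- The action of a word on the names of a model. -/
def Model.eval {V : Type} (M : Model V) (w : Word) (s : V) : V := w.foldr M s

/-- A family of sublocales of `L` that is stable under the three operations, on which they act as
the model `M` prescribes, and whose inclusions all occur in the order of the names. -/
structure Model.Realization {V : Type} [LE V] (M : Model V) (L : Type u) [Order.Frame L] where
  /-- The sublocale with a given name. -/
  toSub : V → Sublocale L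
  op_toSub : ∀ x s, x.op (toSub s) = toSub (M x s)
  le_of_toSub_le : ∀ s t, toSub s ≤ toSub t → s ≤ t

/-- An inequality that holds in general holds in every model that has a realization. -/
theorem Model.Realization.eval_le_eval {V : Type} [LE V] {M : Model V} {L : Type u}
    [Order.Frame L] (R : M.Realization L) {v w : Word} (h : HoldsLE.{u} v w) (s : V) :
    M.eval v s ≤ M.eval w s := by
  have op_eval (w : Word) : Word.op w (R.toSub s) = R.toSub (M.eval w s) := by
    induction w with
    | nil => rfl
    | cons x w ih => rw [Word.op, ih, R.op_toSub]; rfl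
  apply R.le_of_toSub_le
  rw [← op_eval, ← op_eval]
  exact h L _

/-- The space of two open points and one closed point (the middle one) in the closure of both;
a subset is named by its characteristic function. -/
def threePointModel : Model (Bool × Bool × Bool)
  | .c, (x, y, z) => (x, x || y || z, z)
  | .i, (x, y, z) => (x, x && y && z, z)
  | .n, (x, y, z) => (!x, !y, !z)

/-- A Boolean algebra of sublocales generated by two complementary dense sublocales. -/
def resolvableModel : Model (Bool × Bool)
  | .c, (x, y) => (x || y, x || y)
  | .i, (x, y) => (x && y, x && y)
  | .n, (x, y) => (!x, !y)

/-- The chain `⊥ < S < ⊤` where `S` is a dense sublocale with `-S = ⊤`. -/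
def smallDenseModel : Model (Fin 3)
  | .c, s => if s = 0 then 0 else 2
  | .i, s => if s = 2 then 2 else 0
  | .n, s => if s = 2 then 0 else 2

/-- The inequality between `v` and `w` holds in the three models. -/
def ModelLE (v w : Word) : Prop :=
  (∀ s, threePointModel.eval v s ≤ threePointModel.eval w s) ∧
  (∀ s, resolvableModel.eval v s ≤ resolvableModel.eval w s) ∧
  (∀ s, smallDenseModel.eval v s ≤ smallDenseModel.eval w s)

instance (v w : Word) : Decidable (ModelLE v w) := inferInstanceAs (Decidable (_ ∧ _))

/-! ### The models determine the diagram -/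

/-- The words reached from `v` by ascending paths of length at most `k`. -/
def reach : ℕ → Word → List Word
  | 0, v => [v]
  | k + 1, v => v :: (edges.filter fun e => e.1 = v).flatMap fun e => reach k e.2

theorem diagramLE_of_mem_reach {k : ℕ} {v w : Word} (h : w ∈ reach k v) : DiagramLE v w := by
  induction k generalizing v with
  | zero => rw [List.mem_singleton.1 h]; exact .refl
  | succ k ih =>
    rcases List.mem_cons.1 h with rfl | h
    · exact .refl
    · obtain ⟨⟨x, y⟩, he, hw⟩ := List.mem_flatMap.1 h
      simp only [List.mem_filter, decide_eq_true_eq] at he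
      obtain ⟨he, rfl⟩ := he
      exact .head he (ih hw)

/-- An inequality that is not refuted by the models is witnessed by a path; no path has more than
five edges. -/
theorem mem_reach_of_modelLE :
    ∀ v ∈ nodes, ∀ w ∈ nodes, ModelLE v w → w ∈ reach 5 v := by
  decide +kernel

theorem modelLE_antisymm :
    ∀ v ∈ nodes, ∀ w ∈ nodes, ModelLE v w → ModelLE w v → v = w := by
  decide +kernel

/-- No node lies strictly between the ends of an edge in the order given by the models. -/
theorem edge_covBy : ∀ e ∈ edges, e.1 ≠ e.2 ∧ e.2 ∈ nodes ∧
    ∀ z ∈ nodes, ModelLE e.1 z → ModelLE z e.2 → z = e.1 ∨ z = e.2 := by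
  decide +kernel

/-! ### Realizing the three-point model -/

/-- In a locale with an element `a` that is regular but not complemented, the open sublocales of
`a` and `aᶜ` and the closed sublocale of `a ⊔ aᶜ` play the part of the three points. -/
def threePointRealization {L : Type u} [Order.Frame L] {a b : L} (hab : aᶜ = b) (hba : bᶜ = a)
    (h : a ⊔ b ≠ ⊤) : threePointModel.Realization L where
  toSub
    | (false, false, false) => ⊥
    | (true, false, false) => openSublocale a
    | (false, false, true) => openSublocale b
    | (false, true, false) => closedSublocale (a ⊔ b)
    | (true, true, false) => closedSublocale b
    | (false, true, true) => closedSublocale a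
    | (true, false, true) => openSublocale (a ⊔ b)
    | (true, true, true) => ⊤
  op_toSub := by
    have hc : (a ⊔ b)ᶜ = ⊥ := by rw [compl_sup, hab, hba, inf_comm, ← hab, inf_compl_self]
    rintro (_ | _ | _) ⟨_ | _, _ | _, _ | _⟩ <;>
    simp [threePointModel, Letter.op, closure_closedSublocale, interior_openSublocale,
      closure_openSublocale, interior_closedSublocale, hab, hba, hc, closure_bot, closure_top,
      interior_bot, interior_top, hnot_openSublocale, hnot_closedSublocale, openSublocale_bot,
      closedSublocale_bot]
  le_of_toSub_le := by
    have ha : a ≠ ⊤ := by rintro rfl; exact h (top_sup_eq _)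
    have hb : b ≠ ⊤ := by rintro rfl; exact h (sup_top_eq _)
    have ha' : a ≠ ⊥ := by rintro rfl; exact hb (by rw [← hab, compl_bot])
    have hb' : b ≠ ⊥ := by rintro rfl; exact ha (by rw [← hba, compl_bot])
    have hd : Disjoint a b := hab ▸ disjoint_compl_right
    have ht : (⊤ : L) ≠ ⊥ := fun h' => h ((le_top.trans h'.le).antisymm bot_le |>.trans h'.symm)
    have hle : ¬ a ≤ b := fun h' => ha' (hd.eq_bot_of_le h')
    have hle' : ¬ b ≤ a := fun h' => hb' (hd.symm.eq_bot_of_le h')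
    rintro ⟨_ | _, _ | _, _ | _⟩ ⟨_ | _, _ | _, _ | _⟩ <;>
    simp [← openSublocale_bot, ← openSublocale_top, openSublocale_le_openSublocale,
      openSublocale_le_closedSublocale, closedSublocale_le_openSublocale, sup_comm b a,
      closedSublocale_le_closedSublocale, *]

/-- The open half-line `(0, ∞)`. -/
def posHalfLine : TopologicalSpace.Opens (ULift.{u} ℝ) :=
  ⟨{x | 0 < x.down}, isOpen_lt continuous_const continuous_uliftDown⟩

/-- The open half-line `(-∞, 0)`. -/
def negHalfLine : TopologicalSpace.Opens (ULift.{u} ℝ) :=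
  ⟨{x | x.down < 0}, isOpen_lt continuous_uliftDown continuous_const⟩

theorem compl_posHalfLine : posHalfLine.{u}ᶜ = negHalfLine := by
  apply TopologicalSpace.Opens.ext
  have h : ((posHalfLine.{u} : Set (ULift.{u} ℝ))ᶜ) = Homeomorph.ulift ⁻¹' Set.Iic 0 := by
    ext x; exact not_lt (α := ℝ)
  rw [TopologicalSpace.Opens.coe_compl_eq_interior_compl, h, ← Homeomorph.preimage_interior,
    interior_Iic]
  rfl

theorem compl_negHalfLine : negHalfLine.{u}ᶜ = posHalfLine := by
  apply TopologicalSpace.Opens.ext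
  have h : ((negHalfLine.{u} : Set (ULift.{u} ℝ))ᶜ) = Homeomorph.ulift ⁻¹' Set.Ici 0 := by
    ext x; exact not_lt (α := ℝ)
  rw [TopologicalSpace.Opens.coe_compl_eq_interior_compl, h, ← Homeomorph.preimage_interior,
    interior_Ici]
  rfl

theorem posHalfLine_sup_negHalfLine_ne_top : posHalfLine.{u} ⊔ negHalfLine ≠ ⊤ := fun h => by
  have h0 : (⟨0⟩ : ULift.{u} ℝ) ∈ posHalfLine.{u} ⊔ negHalfLine := h ▸ trivial
  rcases h0 with h0 | h0 <;> exact lt_irrefl (0 : ℝ) h0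

/-! ### Totally ordered locales -/

section Total

variable {L : Type*} [Order.Frame L]

theorem himp_eq_top_or_eq_right (total : ∀ a b : L, a ≤ b ∨ b ≤ a) (a b : L) :
    a ⇨ b = ⊤ ∨ a ⇨ b = b := by
  by_cases h : a ≤ b
  · exact .inl (himp_eq_top_iff.2 h)
  · refine .inr (le_antisymm ?_ le_himp)
    rcases total (a ⇨ b) a with h' | h'
    · exact (le_inf le_rfl h').trans himp_inf_le
    · exact absurd ((le_inf h' le_rfl).trans himp_inf_le) h

/-- In a totally ordered locale, the union of two sublocales is a sublocale. -/
theorem mem_or_mem_of_mem_sup (total : ∀ a b : L, a ≤ b ∨ b ≤ a) {S T : Sublocale L} {x : L}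
    (hx : x ∈ S ⊔ T) : x ∈ S ∨ x ∈ T := by
  let U : Sublocale L :=
    { carrier := S ∪ T
      sInf_mem' := fun s hs => by
        have h : sInf s = sInf (s ∩ S) ⊓ sInf (s ∩ T) := by
          rw [← sInf_union, ← Set.inter_union_distrib_left, Set.inter_eq_left.2 hs]
        have hS : sInf (s ∩ S) ∈ S := S.sInf_mem Set.inter_subset_right
        have hT : sInf (s ∩ T) ∈ T := T.sInf_mem Set.inter_subset_right
        rw [h]
        rcases total (sInf (s ∩ S)) (sInf (s ∩ T)) with h | h
        · rw [inf_eq_left.2 h]; exact .inl hS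
        · rw [inf_eq_right.2 h]; exact .inr hT
      himp_mem' := fun a b hb => hb.imp (fun h => S.himp_mem h) fun h => T.himp_mem h }
  exact (sup_le (fun _ h => Or.inl h) (fun _ h => Or.inr h) : S ⊔ T ≤ U) hx

end Total

/-! ### A descending chain -/

/-- The chain `⊤ = 0 > 1 > 2 > ⋯ > ⊥`, in an arbitrary universe. -/
def DescChain : Type u := ULift.{u} ℕ∞ᵒᵈ

namespace DescChain

noncomputable instance : Order.Frame DescChain.{u} := Equiv.ulift.frame

/-- The `n`-th element from above. -/
def pt (n : ℕ∞) : DescChain.{u} := ⟨OrderDual.toDual n⟩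

theorem exists_eq_pt (x : DescChain.{u}) : ∃ n, x = pt n := ⟨x.down.ofDual, rfl⟩

theorem pt_le_pt {m n : ℕ∞} : pt.{u} m ≤ pt n ↔ n ≤ m := Iff.rfl

theorem pt_injective : Function.Injective pt.{u} := fun _ _ h =>
  le_antisymm (pt_le_pt.1 h.ge) (pt_le_pt.1 h.le)

theorem pt_zero : pt.{u} 0 = ⊤ := by
  obtain ⟨n, hn⟩ := exists_eq_pt.{u} ⊤
  exact top_le_iff.1 (hn ▸ pt_le_pt.2 (zero_le (a := n)))

theorem pt_top : pt.{u} ⊤ = ⊥ := by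
  obtain ⟨n, hn⟩ := exists_eq_pt.{u} ⊥
  exact le_bot_iff.1 (hn ▸ pt_le_pt.2 le_top)

theorem total (a b : DescChain.{u}) : a ≤ b ∨ b ≤ a := by
  obtain ⟨m, rfl⟩ := exists_eq_pt a
  obtain ⟨n, rfl⟩ := exists_eq_pt b
  exact le_total n m

theorem sInf_eq_pt (s : Set DescChain.{u}) : sInf s = pt (sSup (pt ⁻¹' s)) := by
  apply le_antisymm
  · obtain ⟨n, hn⟩ := exists_eq_pt (sInf s)
    rw [hn, pt_le_pt]
    exact sSup_le fun m hm => pt_le_pt.1 (hn ▸ sInf_le hm)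
  · refine le_sInf fun x hx => ?_
    obtain ⟨n, rfl⟩ := exists_eq_pt x
    exact pt_le_pt.2 (le_sSup hx)

/-- The sublocale that consists of `⊤`, `⊥` and the elements with index in `A`. -/
def sub (A : Set ℕ) : Sublocale DescChain.{u} where
  carrier := {x | ∀ n : ℕ, x = pt n → n = 0 ∨ n ∈ A}
  sInf_mem' s hs n hn := by
    -- a meet of index `n ∉ {0, ∞}` is attained
    by_contra! h
    rw [sInf_eq_pt] at hn
    have hsup := pt_injective hn
    have hne : (pt ⁻¹' s).Nonempty := by
      rw [Set.nonempty_iff_ne_empty]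
      intro h0
      rw [h0, sSup_empty, bot_eq_zero] at hsup
      exact h.1 (by exact_mod_cast hsup.symm)
    have := hne.to_subtype
    have hmem := ENat.sSup_mem_of_nonempty_of_lt_top (hsup ▸ ENat.natCast_lt_top n)
    rw [hsup] at hmem
    exact (hs hmem n rfl).elim h.1 h.2
  himp_mem' a b hb := by
    rcases himp_eq_top_or_eq_right total a b with h | h <;> rw [h]
    · intro n hn
      rw [← pt_zero] at hn
      exact .inl (by exact_mod_cast (pt_injective hn).symm)
    · exact hb

variable {A B : Set ℕ}

theorem pt_mem_sub {n : ℕ} : pt.{u} n ∈ sub A ↔ n = 0 ∨ n ∈ A :=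
  ⟨fun h => h n rfl, fun h m hm => by
    have : n = m := by exact_mod_cast pt_injective hm
    exact this ▸ h⟩

theorem bot_mem_sub : ⊥ ∈ sub.{u} A := fun n hn => by
  rw [← pt_top] at hn
  exact absurd (pt_injective hn).symm (ENat.natCast_ne_top n)

theorem sub_univ : sub.{u} Set.univ = ⊤ := top_le_iff.1 fun _ _ _ _ => .inr trivial

theorem closure_sub : closure (sub.{u} A) = ⊤ := closure_eq_top bot_mem_sub

theorem interior_sub (hA : Aᶜ.Infinite) : interior (sub.{u} A) = ⊥ := by
  obtain ⟨a, ha⟩ := interior_eq_openSublocale (sub.{u} A)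
  obtain ⟨m, rfl⟩ := exists_eq_pt a
  induction m with
  | top => rw [ha, pt_top, openSublocale_bot]
  | coe m =>
    -- a nontrivial open sublocale contains all elements from some index on
    obtain ⟨n, hn, hmn⟩ := hA.exists_gt m
    have hmem : pt n ∈ openSublocale (pt.{u} m) := by
      rw [mem_openSublocale]
      refine (himp_eq_top_or_eq_right total _ _).resolve_left fun h => ?_
      rw [himp_eq_top_iff, pt_le_pt, Nat.cast_le] at h
      omega
    rw [← ha] at hmem
    rcases pt_mem_sub.1 (interior_le _ hmem) with h | h
    · omega
    · exact absurd h hn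

/-- Every element of index outside `A` must lie in the supplement, and then so does `⊥`, the meet
of these elements. -/
theorem hnot_sub (hA : Aᶜ.Infinite) : ￢sub.{u} A = sub Aᶜ := by
  apply le_antisymm
  · refine (isLeast_supplement _).2 (top_le_iff.1 fun x _ => ?_)
    by_cases hx : x ∈ sub A
    · exact (le_sup_left : sub A ≤ sub A ⊔ sub Aᶜ) hx
    · obtain ⟨n, rfl, hn⟩ : ∃ n : ℕ, x = pt n ∧ ¬ (n = 0 ∨ n ∈ A) := by
        simpa only [not_forall, exists_prop] using
          (show ¬ ∀ n : ℕ, x = pt n → n = 0 ∨ n ∈ A from hx)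
      exact (le_sup_right : sub Aᶜ ≤ sub A ⊔ sub Aᶜ) (pt_mem_sub.2 (.inr fun h => hn (.inr h)))
  · have hcoe (n : ℕ) (hn : n ∈ Aᶜ) : pt n ∈ ￢sub.{u} A := by
      rcases eq_or_ne n 0 with rfl | h0
      · rw [Nat.cast_zero, pt_zero]; exact Sublocale.top_mem
      · have h : pt.{u} n ∈ sub A ⊔ ￢sub A := by
          rw [(isLeast_supplement (sub.{u} A)).1]; exact mem_top
        exact (mem_or_mem_of_mem_sup total h).resolve_left fun h => (pt_mem_sub.1 h).elim h0 hn
    intro x hx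
    obtain ⟨n, rfl⟩ := exists_eq_pt x
    induction n with
    | top =>
      have h : sInf (pt.{u} '' ((↑) '' Aᶜ)) = pt ⊤ := by
        rw [sInf_eq_pt, Set.preimage_image_eq _ pt_injective,
          ENat.sSup_eq_top_of_infinite (hA.image Nat.cast_injective.injOn)]
      rw [← h]
      refine Sublocale.sInf_mem ?_
      rintro _ ⟨_, ⟨n, hn, rfl⟩, rfl⟩
      exact hcoe n hn
    | coe n =>
      rcases pt_mem_sub.1 hx with rfl | h
      · rw [Nat.cast_zero, pt_zero]; exact Sublocale.top_mem
      · exact hcoe n h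

theorem not_sub_le_sub {n : ℕ} (h0 : n ≠ 0) (hA : n ∈ A) (hB : n ∉ B) :
    ¬ sub.{u} A ≤ sub B := fun h =>
  (pt_mem_sub.1 (h (pt_mem_sub.2 (.inr hA)))).elim h0 hB

theorem sub_ne_bot : sub.{u} A ≠ ⊥ := fun h => by
  have h' : (⊥ : DescChain.{u}) = ⊤ := mem_bot.1 (h ▸ bot_mem_sub)
  rw [← pt_top, ← pt_zero] at h'
  exact ENat.top_ne_zero (pt_injective h')

theorem sub_ne_top {n : ℕ} (h0 : n ≠ 0) (hA : n ∉ A) : sub.{u} A ≠ ⊤ := fun h =>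
  (pt_mem_sub.1 (h ▸ mem_top : pt n ∈ sub.{u} A)).elim h0 hA

theorem bot_ne_top : (⊥ : Sublocale DescChain.{u}) ≠ ⊤ := fun h =>
  sub_ne_bot (sub_univ.trans h.symm)

/-- Parity of the index splits the chain into two complementary dense sublocales. -/
noncomputable def resolvableRealization : resolvableModel.Realization DescChain.{u} where
  toSub
    | (false, false) => ⊥
    | (true, false) => sub {n | Even n}
    | (false, true) => sub {n | Even n}ᶜ
    | (true, true) => ⊤
  op_toSub := by
    have hodd : {n : ℕ | Even n}ᶜ.Infinite :=
      Set.infinite_of_injective_forall_mem (f := fun n => 2 * n + 1) (fun m n h => by simpa using h)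
        fun n => by simp
    have heven : {n : ℕ | Even n}ᶜᶜ.Infinite :=
      Set.infinite_of_injective_forall_mem (f := fun n => 2 * n) (fun m n h => by simpa using h)
        fun n => by simp
    rintro (_ | _ | _) ⟨_ | _, _ | _⟩ <;>
    simp only [resolvableModel, Letter.op, closure_bot, closure_top, interior_bot, interior_top,
      hnot_bot, hnot_top, closure_sub, interior_sub hodd, interior_sub heven, hnot_sub hodd,
      hnot_sub heven, compl_compl, Bool.or_true, Bool.or_false, Bool.and_true, Bool.and_false,
      Bool.not_true, Bool.not_false]
  le_of_toSub_le := by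
    have h12 := not_sub_le_sub.{u} (A := {n | Even n}) (B := {n | Even n}ᶜ) two_ne_zero
      (by simp) (by simp)
    have h21 := not_sub_le_sub.{u} (A := {n | Even n}ᶜ) (B := {n | Even n}) one_ne_zero
      (by simp) (by simp)
    have h1 := sub_ne_top.{u} (A := {n | Even n}) one_ne_zero (by simp)
    have h2 := sub_ne_top.{u} (A := {n | Even n}ᶜ) two_ne_zero (by simp)
    rintro ⟨_ | _, _ | _⟩ ⟨_ | _, _ | _⟩ <;>
    simp [sub_ne_bot, bot_ne_top.symm, h12, h21, h1, h2]

/-- The sublocale `{⊤, ⊥}` is dense, while its supplement is the whole chain. -/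
noncomputable def smallDenseRealization : smallDenseModel.Realization DescChain.{u} where
  toSub
    | 0 => ⊥
    | 1 => sub ∅
    | 2 => ⊤
  op_toSub := by
    have h : (∅ : Set ℕ)ᶜ.Infinite := by simpa using Set.infinite_univ
    have h' : ￢sub.{u} ∅ = ⊤ := by rw [hnot_sub h, Set.compl_empty, sub_univ]
    intro x s
    fin_cases s <;> cases x <;>
    simp [smallDenseModel, Letter.op, closure_bot, closure_top, interior_bot, interior_top,
      closure_sub, interior_sub h, h']
  le_of_toSub_le := by
    have h1 := sub_ne_top.{u} (A := ∅) one_ne_zero (by simp)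
    intro s t
    fin_cases s <;> fin_cases t <;>
    simp [sub_ne_bot, bot_ne_top.symm, h1]

end DescChain

/-! ### The order of the operators -/

theorem HoldsLE.modelLE {v w : Word} (h : HoldsLE.{u} v w) : ModelLE v w :=
  ⟨(threePointRealization.{u} compl_posHalfLine compl_negHalfLine
      posHalfLine_sup_negHalfLine_ne_top).eval_le_eval h,
    DescChain.resolvableRealization.eval_le_eval h,
    DescChain.smallDenseRealization.eval_le_eval h⟩

theorem holdsLE_iff_diagramLE {v w : Word} (hv : v ∈ nodes) (hw : w ∈ nodes) :
    HoldsLE.{u} v w ↔ DiagramLE v w :=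
  ⟨fun h => diagramLE_of_mem_reach (mem_reach_of_modelLE v hv w hw h.modelLE), DiagramLE.holdsLE⟩

theorem edge_iff_covers {v w : Word} (hv : v ∈ nodes) (hw : w ∈ nodes) :
    Edge v w ↔ HoldsLE.{u} v w ∧ v ≠ w ∧
      ∀ z ∈ nodes, HoldsLE.{u} v z → HoldsLE.{u} z w → z = v ∨ z = w := by
  constructor
  · intro h
    obtain ⟨hne, -, hz⟩ := edge_covBy _ h
    exact ⟨h.holdsLE, hne, fun z hz' h₁ h₂ => hz z hz' h₁.modelLE h₂.modelLE⟩
  · rintro ⟨hle, hne, hcov⟩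
    -- the first step of a path from `v` to `w` must already end at `w`
    rcases Relation.ReflTransGen.cases_head ((holdsLE_iff_diagramLE hv hw).1 hle) with
      rfl | ⟨z, hvz, hzw⟩
    · exact absurd rfl hne
    · obtain ⟨hvz', hz, -⟩ := edge_covBy _ hvz
      rcases hcov z hz hvz.holdsLE (DiagramLE.holdsLE hzw) with rfl | rfl
      · exact absurd rfl hvz'
      · exact hvz

end LocalicCIS

theorem mainTheorem1 :
    -- every composite of `c`, `i`, `-` equals, in all locales, one of the 21 listed operators
    (∀ w : LocalicCIS.Word, ∃ v ∈ LocalicCIS.nodes, LocalicCIS.HoldsEq.{u} w v) ∧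
    -- the listed operators are pairwise distinct in general
    (∀ v ∈ LocalicCIS.nodes, ∀ w ∈ LocalicCIS.nodes, LocalicCIS.HoldsEq.{u} v w → v = w) ∧
    -- an inequality holds in general exactly when the diagram shows it
    (∀ v ∈ LocalicCIS.nodes, ∀ w ∈ LocalicCIS.nodes,
      (LocalicCIS.HoldsLE.{u} v w ↔ LocalicCIS.DiagramLE v w)) ∧
    -- the edges are exactly the covering pairs of this order
    (∀ v ∈ LocalicCIS.nodes, ∀ w ∈ LocalicCIS.nodes,
      (LocalicCIS.Edge v w ↔
        LocalicCIS.HoldsLE.{u} v w ∧ v ≠ w ∧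
          ∀ z ∈ LocalicCIS.nodes, LocalicCIS.HoldsLE.{u} v z → LocalicCIS.HoldsLE.{u} z w →
            z = v ∨ z = w)) := by
  refine ⟨LocalicCIS.exists_node, fun v hv w hw h => ?_,
    fun v hv w hw => LocalicCIS.holdsLE_iff_diagramLE hv hw,
    fun v hv w hw => LocalicCIS.edge_iff_covers hv hw⟩
  have hvw : LocalicCIS.HoldsLE.{u} v w := fun L _ S => (h L S).le
  have hwv : LocalicCIS.HoldsLE.{u} w v := fun L _ S => (h L S).ge
  exact LocalicCIS.modelLE_antisymm v hv w hw hvw.modelLE hwv.modelLE
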